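/- For $n\ge 0$ let $A_n(t)=\sum_{\pi\in\mathfrak S_n}t^{\mathrm{exc}(\pi)}$ be the $n$th Eulerian polynomial, where $\mathrm{exc}(\pi)=|\{i:\pi(i)>i\}|$, and put $$\tilde A_n(t)=1+t\sum_{m=1}^n\binom nm A_m(t),\qquad A^*_n(t)=1+t\sum_{k=1}^n\binom nk(1+t)^kA_k(t).$$ Let $\mathcal L$ be the operator that maps a sequence $(f_i)$ of polynomials with real coefficients to the sequence $(g_i)$ given by $g_i=f_{i+1}f_{i-1}-f_i^2$, for all $i$ such that $f_{i-1}$ is a term of the sequence. A sequence $(f_i)$ is called $k$-$q$-log-convex if all the polynomials in $\mathcal L^k(f_i)$ have non-negative coefficients. **Theorem.** The polynomial sequences $\{\tilde A_n(q)\}_{n\ge 1}$ and $\{A^*_n(q)\}_{n\ge 1}$ are $3$-$q$-log-convex. -/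

import Mathlib

open Polynomial

/-- The number `exc(π) = #{i : π(i) > i}` of excedances of a permutation `π` of `n` letters
(the last letter is never an excedance). -/
def excedances {n : ℕ} (π : Equiv.Perm (Fin n)) : ℕ :=
  (Finset.univ.filter fun i : Fin n => i < π i).card

/-- The Eulerian polynomial `A_n(t) = ∑_{π ∈ S_n} t ^ exc(π)`. -/
noncomputable def eulerianPoly (n : ℕ) : ℝ[X] :=
  ∑ π : Equiv.Perm (Fin n), X ^ excedances π

/-- The binomial-Eulerian polynomial `1 + t ∑_{m=1}^n (n choose m) A_m(t)`. -/
noncomputable def binomialEulerian (n : ℕ) : ℝ[X] :=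
  1 + X * ∑ m ∈ Finset.Icc 1 n, (n.choose m : ℝ[X]) * eulerianPoly m

/-- The type B binomial-Eulerian polynomial
`A*_n(t) = 1 + t ∑_{k=1}^n (n choose k) (1 + t)^k A_k(t)`. -/
noncomputable def binomialEulerianB (n : ℕ) : ℝ[X] :=
  1 + X * ∑ k ∈ Finset.Icc 1 n, (n.choose k : ℝ[X]) * (1 + X) ^ k * eulerianPoly k

/-- The operator `g_i = f_{i+1} f_{i-1} - f_i ^ 2` on sequences of polynomials. It is defined
where both neighbours of `f_i` exist, so for a sequence that starts at index `0` the output is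
`g_1, g_2, …`; it is relabelled here to start at index `0` again, `n` standing for `i - 1`. -/
noncomputable def qLogOperator (f : ℕ → ℝ[X]) : ℕ → ℝ[X] :=
  fun n => f (n + 2) * f n - f (n + 1) ^ 2

/-- A sequence of polynomials is `k`-`q`-log-convex if the `k`-fold iterate of `qLogOperator`
turns it into a sequence of polynomials with non-negative coefficients. -/
def IsQLogConvex (k : ℕ) (f : ℕ → ℝ[X]) : Prop :=
  ∀ n j : ℕ, 0 ≤ ((qLogOperator^[k] f) n).coeff j

/-! Both sequences have the form `1 + X * ∑ (n choose m) * r ^ m * A_m`, with `r = 1` or `r = 1 +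
X`. A Riccati equation for the Eulerian generating function makes this form column 0 of a
tridiagonal array (`isEulerianArray_eulerianColumn`). The Hankel determinants of that column are
products of two minors of the array and a power of `X` (`hankel_det_mem`); the minors have
non-negative coefficients because the tridiagonal step splits into two staircase substitutions
(`minor_mem`). Finally, the third iterate of `qLogOperator` is a polynomial with positive
coefficients in Hankel determinants of order at most 4. -/

/-! ### Minors under staircase substitutions -/

/-- The expansion of a determinant whose columns are finite linear combinations. -/
theorem Matrix.det_sum_columns {R : Type*} [CommRing R] {k : ℕ} (T : Fin k → Finset ℕ)
    (v : Fin k → ℕ → R) (M : ℕ → Fin k → R) :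
    (Matrix.of fun i j => ∑ c ∈ T j, v i c * M c j).det =
      ∑ g ∈ Fintype.piFinset T, (∏ j, M (g j) j) * (Matrix.of fun i j => v i (g j)).det := by
  rw [← Matrix.det_transpose]
  have h : (Matrix.of fun i j => ∑ c ∈ T j, v i c * M c j).transpose =
      fun j => ∑ c ∈ T j, M c j • fun i => v i c := by
    ext j i
    simp [mul_comm]
  rw [h]
  change Matrix.detRowAlternating.toMultilinearMap _ = _
  rw [MultilinearMap.map_sum_finset]
  refine Finset.sum_congr rfl fun g _ => ?_
  rw [MultilinearMap.map_smul_univ, ← Matrix.det_transpose]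
  rfl

/-- A staircase-shaped linear substitution with coefficients in a subsemiring maps a family of
rows all of whose minors lie in the subsemiring to another such family. -/
theorem Matrix.det_mem_of_staircase {R : Type*} [CommRing R] (N : Subsemiring R) {k : ℕ}
    (v : Fin k → ℕ → R)
    (hv : ∀ s : Fin k → ℕ, StrictMono s → (Matrix.of fun i j => v i (s j)).det ∈ N)
    (T : ℕ → Finset ℕ) (hT : ∀ a b, a < b → ∀ c ∈ T a, ∀ d ∈ T b, c ≤ d)
    (M : ℕ → ℕ → R) (hM : ∀ c s, M c s ∈ N) (s : Fin k → ℕ) (hs : StrictMono s) :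
    (Matrix.of fun i j => ∑ c ∈ T (s j), v i c * M c (s j)).det ∈ N := by
  rw [Matrix.det_sum_columns (fun j => T (s j)) v (fun c j => M c (s j))]
  refine N.sum_mem fun g hg => N.mul_mem (N.prod_mem fun j _ => hM _ _) ?_
  rw [Fintype.mem_piFinset] at hg
  -- Each surviving choice of columns is weakly increasing: it is either a genuine minor or has a
  -- repeated column.
  have hmono : Monotone g := fun a b hab => by
    rcases hab.eq_or_lt with rfl | h
    · rfl
    · exact hT _ _ (hs h) _ (hg a) _ (hg b)
  by_cases hinj : Function.Injective g
  · exact hv g (hmono.strictMono_of_injective hinj)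
  · obtain ⟨a, b, hab, hne⟩ := Function.not_injective_iff.mp hinj
    rw [Matrix.det_zero_of_column_eq hne (fun i => by simp [hab])]
    exact N.zero_mem

theorem Fin.le_apply_of_strictMono {l : ℕ} {s : Fin l → ℕ} (hs : StrictMono s) (j : Fin l) :
    (j : ℕ) ≤ s j := by
  obtain ⟨m, hm⟩ := j
  induction m with
  | zero => exact Nat.zero_le _
  | succ m ih =>
    exact (ih (by omega)).trans_lt (hs (Fin.mk_lt_mk.mpr m.lt_succ_self))

/-! ### Jacobi-type arrays and their Hankel determinants -/

/-- An array of Jacobi type with diagonal weights `1 + r * j + r * t * (j + 1)` and off-diagonal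
weights `r * j` and `r * t * (j + 1)`. -/
structure IsEulerianArray {R : Type*} [CommRing R] (r t : R) (k : ℕ → ℕ → R) : Prop where
  zero_zero : k 0 0 = 1
  zero_succ : ∀ j, k 0 (j + 1) = 0
  succ : ∀ n j, k (n + 1) j = r * j * k n (j - 1) + (1 + r * j + r * t * (j + 1)) * k n j +
    r * t * (j + 1) * k n (j + 1)

namespace IsEulerianArray

variable {R : Type*} [CommRing R] {r t : R} {k : ℕ → ℕ → R}

theorem eq_zero (h : IsEulerianArray r t k) {n j : ℕ} (hj : n < j) : k n j = 0 := by
  induction n generalizing j with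
  | zero => obtain ⟨j, rfl⟩ := Nat.exists_eq_succ_of_ne_zero hj.ne'; exact h.zero_succ j
  | succ n ih => rw [h.succ, ih (by omega), ih (by omega), ih (by omega)]; ring

theorem mem (h : IsEulerianArray r t k) (N : Subsemiring R) (hr : r ∈ N) (ht : t ∈ N)
    (n j : ℕ) : k n j ∈ N := by
  induction n generalizing j with
  | zero =>
    cases j with
    | zero => rw [h.zero_zero]; exact N.one_mem
    | succ j => rw [h.zero_succ]; exact N.zero_mem
  | succ n ih =>
    have hj : (j : R) ∈ N := natCast_mem N j
    have hj' : (j : R) + 1 ∈ N := N.add_mem hj N.one_mem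
    rw [h.succ]
    exact N.add_mem (N.add_mem (N.mul_mem (N.mul_mem hr hj) (ih _))
      (N.mul_mem (N.add_mem (N.add_mem N.one_mem (N.mul_mem hr hj))
        (N.mul_mem (N.mul_mem hr ht) hj')) (ih _)))
      (N.mul_mem (N.mul_mem (N.mul_mem hr ht) hj') (ih _))

/-- The tridiagonal step is self-adjoint for the weights `t ^ j`, so the truncated sum telescopes to
a boundary term, as in Christoffel–Darboux. At `l = 0` the factor `l` kills the junk index `l - 1`.
-/
theorem sum_succ_sub (h : IsEulerianArray r t k) (n m l : ℕ) :
    ∑ j ∈ Finset.range l, t ^ j * k (n + 1) j * k m j -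
      ∑ j ∈ Finset.range l, t ^ j * k n j * k (m + 1) j =
    r * l * t ^ l * (k n l * k m (l - 1) - k n (l - 1) * k m l) := by
  induction l with
  | zero => simp
  | succ l ih =>
    rw [Finset.sum_range_succ, Finset.sum_range_succ, add_sub_add_comm, ih, h.succ, h.succ]
    simp only [Nat.add_sub_cancel]
    push_cast
    ring

theorem sum_eq (h : IsEulerianArray r t k) (n m l : ℕ) (hl : n + m < l) :
    ∑ j ∈ Finset.range l, t ^ j * k n j * k m j = k (n + m) 0 := by
  induction m generalizing n with
  | zero =>
    rw [Finset.sum_eq_single 0]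
    · simp [h.zero_zero]
    · intro j _ hj
      rw [h.eq_zero (n := 0) (by omega), mul_zero]
    · intro h0; simp at h0; omega
  | succ m ih =>
    have h1 := h.sum_succ_sub n m l
    rw [h.eq_zero (n := n) (j := l) (by omega), h.eq_zero (n := m) (j := l) (by omega)] at h1
    rw [zero_mul, mul_zero, sub_zero, mul_zero, sub_eq_zero] at h1
    rw [← h1, ih (n + 1) (by omega)]
    congr 1; omega

theorem hankel_eq (h : IsEulerianArray r t k) (n : ℕ) {m l : ℕ} (hm : m < l) :
    k (n + m) 0 = ∑ j ∈ Finset.range l, t ^ j * k n j * k m j := by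
  rw [← h.sum_eq n m (n + m + l) (by omega)]
  symm
  refine Finset.sum_subset (Finset.range_mono (by omega)) fun j _ hj => ?_
  rw [h.eq_zero (n := m), mul_zero]
  simp at hj; omega

theorem minor_mem (h : IsEulerianArray r t k) (N : Subsemiring R) (hr : r ∈ N) (ht : t ∈ N)
    {l : ℕ} (n : ℕ) (s : Fin l → ℕ) (hs : StrictMono s) :
    (Matrix.of fun (i : Fin l) j => k (n + i) (s j)).det ∈ N := by
  induction n generalizing s with
  | zero =>
    rw [Matrix.det_of_isLowerTriangular]
    · exact N.prod_mem fun i _ => h.mem N hr ht _ _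
    · intro i j hij
      have h1 : (i : ℕ) < j := hij
      have h2 : (j : ℕ) ≤ s j := Fin.le_apply_of_strictMono hs j
      exact h.eq_zero (by omega)
  | succ n ih =>
    -- With `u (2a) = k (a-1) + k a` and `u (2a+1) = k a`, the step reads `r a u(2a) + u(2a+1) + r t
    -- (a+1) u(2a+2)`. `T₁` encodes `u`, and `T₂` with `M` encodes the outer sum. At `a = 0` the
    -- weight `r a` vanishes, so the truncated `T₁ 0` is harmless.
    let T₁ : ℕ → Finset ℕ := fun m => Finset.Icc ((m - 1) / 2) (m / 2)
    let T₂ : ℕ → Finset ℕ := fun a => Finset.Icc (2 * a) (2 * a + 2)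
    let M : ℕ → ℕ → R := fun c a =>
      if c = 2 * a then r * a else if c = 2 * a + 1 then 1 else r * t * (a + 1)
    have key := Matrix.det_mem_of_staircase N
      (fun (i : Fin l) m => ∑ c ∈ T₁ m, k (n + i) c * 1)
      (Matrix.det_mem_of_staircase N (fun (i : Fin l) c => k (n + i) c) ih T₁ ?_
        (fun _ _ => 1) fun _ _ => N.one_mem) T₂ ?_ M ?_ s hs
    · convert key using 3
      ext i j
      have e : n + 1 + (i : ℕ) = n + i + 1 := by omega
      rw [e, h.succ]
      simp only [T₂, M]
      rw [Finset.sum_Icc_succ_top (by omega), Finset.sum_Icc_succ_top (by omega),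
        Finset.Icc_self, Finset.sum_singleton, if_pos rfl, if_neg (by omega), if_pos rfl,
        if_neg (by omega), if_neg (by omega)]
      generalize s j = a
      have h₁ : T₁ (2 * a + 1) = {a} := by
        rw [← Finset.Icc_self]; simp only [T₁]; congr 1 <;> omega
      have h₂ : ∀ b, T₁ (2 * b + 2) = Finset.Icc b (b + 1) := fun b => by
        simp only [T₁]; congr 1 <;> omega
      have e₂ : 2 * a + 1 + 1 = 2 * a + 2 := rfl
      rw [e₂, h₁, h₂, Finset.sum_Icc_succ_top (by omega), Finset.Icc_self]
      cases a with
      | zero => simp [T₁]; ring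
      | succ b =>
        have e₃ : 2 * (b + 1) = 2 * b + 2 := rfl
        rw [e₃, h₂, Finset.sum_Icc_succ_top (by omega), Finset.Icc_self]
        simp only [Finset.sum_singleton, Nat.add_sub_cancel, mul_one]
        ring
    · intro a b hab c hc d hd
      simp only [T₁, Finset.mem_Icc] at hc hd
      omega
    · intro a b hab c hc d hd
      simp only [T₂, Finset.mem_Icc] at hc hd
      omega
    · intro c a
      have ha : (a : R) ∈ N := natCast_mem N a
      simp only [M]
      split_ifs
      · exact N.mul_mem hr ha
      · exact N.one_mem
      · exact N.mul_mem (N.mul_mem hr ht) (N.add_mem ha N.one_mem)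

theorem hankel_det_mem (h : IsEulerianArray r t k) (N : Subsemiring R) (hr : r ∈ N)
    (ht : t ∈ N) (l n : ℕ) :
    (Matrix.of fun i j : Fin l => k (n + i + j) 0).det ∈ N := by
  have e : (Matrix.of fun i j : Fin l => k (n + i + j) 0) =
      (Matrix.of fun i j : Fin l => k (n + i) j) *
        (Matrix.diagonal fun j : Fin l => t ^ (j : ℕ)) *
        (Matrix.of fun i j : Fin l => k (0 + i) j).transpose := by
    ext i j
    rw [Matrix.of_apply, h.hankel_eq (n + i) j.isLt, Finset.sum_range, Matrix.mul_apply]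
    refine Finset.sum_congr rfl fun a _ => ?_
    simp [Matrix.mul_diagonal, mul_comm]
  rw [e, Matrix.det_mul, Matrix.det_mul, Matrix.det_diagonal, Matrix.det_transpose]
  have hmono : StrictMono fun j : Fin l => (j : ℕ) := fun _ _ h => h
  exact N.mul_mem (N.mul_mem (h.minor_mem N hr ht n _ hmono)
    (N.prod_mem fun i _ => N.pow_mem ht _)) (h.minor_mem N hr ht 0 _ hmono)

end IsEulerianArray

/-! ### From Hankel determinants to log-convexity -/

/-- The subsemiring of real polynomials with non-negative coefficients. -/
def Polynomial.nonnegCoeff : Subsemiring ℝ[X] where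
  carrier := {p | ∀ j, 0 ≤ p.coeff j}
  mul_mem' {p q} hp hq j := by
    rw [coeff_mul]
    exact Finset.sum_nonneg fun x _ => mul_nonneg (hp _) (hq _)
  one_mem' j := by rw [coeff_one]; split_ifs <;> norm_num
  add_mem' {p q} hp hq j := by rw [coeff_add]; exact add_nonneg (hp j) (hq j)
  zero_mem' j := by simp

/-- Positivity of the Hankel minors of order at most four implies `3`-`q`-log-convexity. -/
theorem isQLogConvex_three_of_hankel {f : ℕ → ℝ[X]}
    (hf : ∀ l n, (Matrix.of fun i j : Fin l => f (n + i + j)).det ∈ nonnegCoeff) :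
    IsQLogConvex 3 f := by
  intro n
  have h1 := hf 1 (n + 3)
  have h2 := hf 2 (n + 2)
  have h3 := hf 3 n
  have h3' := hf 3 (n + 2)
  have h4 := hf 4 n
  -- Desnanot–Jacobi, with `H_l` the order-`l` Hankel determinant, gives `L² f n = f (n+2) * H_3 n`;
  -- applied once more to `H_3 (n+1) ^ 2`, it yields this factorization of `L³ f n`.
  have key := nonnegCoeff.mul_mem h2
    (nonnegCoeff.add_mem (nonnegCoeff.mul_mem h3' h3)
      (nonnegCoeff.mul_mem (nonnegCoeff.pow_mem h1 2) h4))
  suffices e : (qLogOperator^[3] f) n ∈ nonnegCoeff from e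
  convert key using 1
  simp only [Function.iterate_succ, Function.iterate_zero, Function.comp, id, qLogOperator]
  simp [Matrix.det_succ_row_zero, Fin.sum_univ_succ, Fin.succAbove, add_assoc]
  ring

/-! ### The Eulerian recurrence -/

theorem excedances_decomposeFin_zero {n : ℕ} (e : Equiv.Perm (Fin n)) :
    excedances (Equiv.Perm.decomposeFin.symm (0, e)) = excedances e := by
  simp only [excedances, Finset.card_filter, Fin.sum_univ_succ]
  simp

/-- The new first letter is an excedance, while the preimage of `q` under `e` is redirected to 0 and
loses its excedance if it had one. -/
theorem excedances_decomposeFin_succ {n : ℕ} (e : Equiv.Perm (Fin n)) (q : Fin n) :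
    excedances (Equiv.Perm.decomposeFin.symm (q.succ, e)) + (if e.symm q < q then 1 else 0) =
      excedances e + 1 := by
  simp only [excedances, Finset.card_filter, Fin.sum_univ_succ]
  rw [Equiv.Perm.decomposeFin_symm_apply_zero, if_pos (Fin.succ_pos q), add_comm 1,
    add_right_comm]
  congr 1
  rw [← Finset.add_sum_erase _ _ (Finset.mem_univ (e.symm q)),
    ← Finset.add_sum_erase (a := e.symm q) _ (fun i => if i < e i then 1 else 0)
      (Finset.mem_univ _)]
  rw [Equiv.Perm.decomposeFin_symm_apply_succ]
  simp only [Equiv.apply_symm_apply, Equiv.swap_apply_right, Fin.not_lt_zero, if_false, zero_add]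
  rw [add_comm]
  congr 1
  refine Finset.sum_congr rfl fun i hi => ?_
  have hne : e i ≠ q := fun h => (Finset.ne_of_mem_erase hi) (by rw [← h, Equiv.symm_apply_apply])
  rw [Equiv.Perm.decomposeFin_symm_apply_succ, Equiv.swap_apply_of_ne_of_ne (Fin.succ_ne_zero _)
    (fun h => hne (Fin.succ_injective _ h))]
  simp

theorem card_excedance_values {n : ℕ} (e : Equiv.Perm (Fin n)) :
    (Finset.univ.filter fun q => e.symm q < q).card = excedances e := by
  rw [excedances]
  refine Finset.card_bij' (fun q _ => e.symm q) (fun i _ => e i) ?_ ?_ ?_ ?_ <;> simp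

theorem sum_X_pow_excedances_decomposeFin {n : ℕ} (e : Equiv.Perm (Fin n)) :
    ∑ p : Fin (n + 1), (X : ℝ[X]) ^ excedances (Equiv.Perm.decomposeFin.symm (p, e)) =
      (1 + (n : ℝ[X]) * X) * X ^ excedances e + X * (1 - X) * derivative (X ^ excedances e) := by
  rw [Fin.sum_univ_succ, excedances_decomposeFin_zero]
  have h : ∀ q : Fin n, (X : ℝ[X]) ^ excedances (Equiv.Perm.decomposeFin.symm (q.succ, e)) =
      X ^ (excedances e + 1) +
        if e.symm q < q then X ^ excedances e * (1 - X) else 0 := fun q => by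
    have := excedances_decomposeFin_succ e q
    split_ifs at this ⊢
    · rw [Nat.add_right_cancel this]; ring
    · rw [← this]; simp
  rw [Finset.sum_congr rfl fun q _ => h q, Finset.sum_add_distrib, ← Finset.sum_filter,
    Finset.sum_const, Finset.sum_const, card_excedance_values, Finset.card_univ, Fintype.card_fin,
    derivative_X_pow]
  cases excedances e with
  | zero => simp
  | succ m => simp; ring

theorem eulerianPoly_zero : eulerianPoly 0 = 1 := by
  simp [eulerianPoly, excedances]

theorem eulerianPoly_succ (n : ℕ) :
    eulerianPoly (n + 1) =
      (1 + (n : ℝ[X]) * X) * eulerianPoly n + X * (1 - X) * derivative (eulerianPoly n) := by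
  rw [eulerianPoly, ← Equiv.sum_comp Equiv.Perm.decomposeFin.symm, Fintype.sum_prod_type_right]
  rw [Finset.sum_congr rfl fun e _ => sum_X_pow_excedances_decomposeFin e,
    Finset.sum_add_distrib, ← Finset.mul_sum, ← Finset.mul_sum, ← derivative_sum, eulerianPoly]

/-! ### Generating functions -/

namespace PowerSeries

/-- The coefficientwise derivative of a power series over a polynomial ring. -/
noncomputable def coeffDerivative (f : PowerSeries ℝ[X]) : PowerSeries ℝ[X] :=
  mk fun n => Polynomial.derivative (coeff n f)

theorem coeffDerivative_add (f g : PowerSeries ℝ[X]) :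
    coeffDerivative (f + g) = coeffDerivative f + coeffDerivative g := by
  ext1 n; simp [coeffDerivative]

theorem coeffDerivative_sub (f g : PowerSeries ℝ[X]) :
    coeffDerivative (f - g) = coeffDerivative f - coeffDerivative g := by
  ext1 n; simp [coeffDerivative]

theorem coeffDerivative_mul (f g : PowerSeries ℝ[X]) :
    coeffDerivative (f * g) = coeffDerivative f * g + f * coeffDerivative g := by
  ext1 n
  simp only [coeffDerivative, coeff_mk, coeff_mul, map_add, Polynomial.derivative_sum,
    Polynomial.derivative_mul, Finset.sum_add_distrib]

theorem coeffDerivative_C (p : ℝ[X]) :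
    coeffDerivative (C p) = C (Polynomial.derivative p) := by
  ext1 n
  simp only [coeffDerivative, coeff_mk, coeff_C]
  split_ifs <;> simp

theorem coeffDerivative_one : coeffDerivative 1 = 0 := by
  rw [← map_one (C (R := ℝ[X])), coeffDerivative_C, Polynomial.derivative_one, map_zero]

theorem derivative_coeffDerivative (f : PowerSeries ℝ[X]) :
    derivative ℝ[X] (coeffDerivative f) = coeffDerivative (derivative ℝ[X] f) := by
  ext1 n
  simp only [coeffDerivative, coeff_mk, coeff_derivative, Polynomial.derivative_mul]
  simp

theorem derivative_rescale {R : Type*} [CommRing R] (r : R) (f : PowerSeries R) :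
    derivative R (rescale r f) = C r * rescale r (derivative R f) := by
  ext1 n
  simp only [coeff_derivative, coeff_rescale, coeff_C_mul]
  ring

end PowerSeries

/-- The exponential generating function of the Eulerian polynomials. -/
noncomputable def eulerianEGF : PowerSeries ℝ[X] :=
  PowerSeries.mk fun n => C ((n.factorial : ℝ)⁻¹) * eulerianPoly n

theorem factorial_mul_coeff_eulerianEGF (n : ℕ) :
    (n.factorial : ℝ[X]) * PowerSeries.coeff n eulerianEGF = eulerianPoly n := by
  have h : (n.factorial : ℝ[X]) = C (n.factorial : ℝ) := by simp
  rw [eulerianEGF, PowerSeries.coeff_mk, h, ← mul_assoc, ← C_mul,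
    mul_inv_cancel₀ (by exact_mod_cast n.factorial_ne_zero), C_1, one_mul]

theorem constantCoeff_eulerianEGF : PowerSeries.constantCoeff eulerianEGF = 1 := by
  rw [← PowerSeries.coeff_zero_eq_constantCoeff_apply, eulerianEGF, PowerSeries.coeff_mk]
  simp [eulerianPoly_zero]

theorem eulerianEGF_pde :
    (1 - PowerSeries.C X * PowerSeries.X) * PowerSeries.derivative ℝ[X] eulerianEGF =
      eulerianEGF + PowerSeries.C (X * (1 - X)) * PowerSeries.coeffDerivative eulerianEGF := by
  ext1 n
  have hX : PowerSeries.coeff n (PowerSeries.X * PowerSeries.derivative ℝ[X] eulerianEGF) =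
      n * PowerSeries.coeff n eulerianEGF := by
    cases n with
    | zero => simp
    | succ n =>
      rw [PowerSeries.coeff_succ_X_mul, PowerSeries.coeff_derivative]; push_cast; ring
  have hn : (n.factorial : ℝ[X]) ≠ 0 := by exact_mod_cast n.factorial_ne_zero
  apply mul_left_cancel₀ hn
  rw [sub_mul, one_mul, mul_assoc, map_sub, map_add, PowerSeries.coeff_C_mul, hX,
    PowerSeries.coeff_C_mul, PowerSeries.coeff_derivative, PowerSeries.coeffDerivative,
    PowerSeries.coeff_mk]
  have h1 := factorial_mul_coeff_eulerianEGF (n + 1)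
  have h0 := factorial_mul_coeff_eulerianEGF n
  have hd : (n.factorial : ℝ[X]) * derivative (PowerSeries.coeff n eulerianEGF) =
      derivative (eulerianPoly n) := by
    rw [← h0, derivative_mul]; simp
  rw [eulerianPoly_succ, Nat.factorial_succ] at h1
  push_cast at h1
  linear_combination h1 - X * (1 - X) * hd - (1 + n * X) * h0

theorem eulerianEGF_ode :
    PowerSeries.derivative ℝ[X] eulerianEGF =
      PowerSeries.C (1 - X) * eulerianEGF + PowerSeries.C X * eulerianEGF ^ 2 := by
  rw [← sub_eq_zero]
  set W := PowerSeries.derivative ℝ[X] eulerianEGF -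
      (PowerSeries.C (1 - X) * eulerianEGF + PowerSeries.C X * eulerianEGF ^ 2) with hW
  have h := eulerianEGF_pde
  have hd := congrArg (PowerSeries.derivative ℝ[X]) h
  -- The defect `W` of the Riccati equation solves a homogeneous linear equation, which determines
  -- each coefficient from the previous one; the constant term is 0.
  have key : (1 - PowerSeries.C X * PowerSeries.X) * PowerSeries.derivative ℝ[X] W =
      PowerSeries.C (X * (1 - X)) * PowerSeries.coeffDerivative W +
        PowerSeries.C (1 + X) * W := by
    rw [hW]
    simp only [PowerSeries.coeffDerivative_sub, PowerSeries.coeffDerivative_add,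
      PowerSeries.coeffDerivative_mul, PowerSeries.coeffDerivative_C, pow_two, Derivation.leibniz,
      map_sub, map_add, map_mul, PowerSeries.derivative_C, PowerSeries.derivative_X, smul_eq_mul,
      PowerSeries.coeffDerivative_one, derivative_X, map_one, PowerSeries.derivative_coeffDerivative,
      PowerSeries.derivative_one] at hd h ⊢
    linear_combination hd - (1 - PowerSeries.C X + 2 * PowerSeries.C X * eulerianEGF) * h
  ext1 n
  rw [map_zero]
  induction n with
  | zero =>
    have h₁ : PowerSeries.coeff (0 + 1) eulerianEGF = 1 := by
      simp [eulerianEGF, eulerianPoly_succ, eulerianPoly_zero]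
    rw [hW, map_sub, PowerSeries.coeff_derivative, h₁]
    simp [constantCoeff_eulerianEGF]
  | succ n ih =>
    have hX : PowerSeries.coeff n (PowerSeries.X * PowerSeries.derivative ℝ[X] W) = 0 := by
      cases n with
      | zero => simp
      | succ n => rw [PowerSeries.coeff_succ_X_mul, PowerSeries.coeff_derivative, ih, zero_mul]
    have := congrArg (PowerSeries.coeff n) key
    rw [sub_mul, one_mul, mul_assoc, map_sub, map_add, PowerSeries.coeff_C_mul, hX,
      PowerSeries.coeff_C_mul, PowerSeries.coeff_derivative, PowerSeries.coeffDerivative,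
      PowerSeries.coeff_mk, PowerSeries.coeff_C_mul, ih] at this
    have hn : ((n : ℝ[X]) + 1) ≠ 0 := by exact_mod_cast n.succ_ne_zero
    simpa [hn] using this

/-- The exponential generating functions of the columns of the array with parameter `r`. -/
noncomputable def eulerianColumn (r : ℝ[X]) (j : ℕ) : PowerSeries ℝ[X] :=
  PowerSeries.exp ℝ[X] * (1 + PowerSeries.C X * PowerSeries.rescale r (eulerianEGF - 1)) *
    PowerSeries.rescale r (eulerianEGF - 1) ^ j

theorem constantCoeff_rescale_eulerianEGF (r : ℝ[X]) :
    PowerSeries.constantCoeff (PowerSeries.rescale r eulerianEGF) = 1 := by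
  rw [← PowerSeries.coeff_zero_eq_constantCoeff_apply, PowerSeries.coeff_rescale, pow_zero, one_mul,
    PowerSeries.coeff_zero_eq_constantCoeff_apply, constantCoeff_eulerianEGF]

theorem derivative_rescale_eulerianEGF (r : ℝ[X]) :
    PowerSeries.derivative ℝ[X] (PowerSeries.rescale r (eulerianEGF - 1)) =
      PowerSeries.C r * (1 + PowerSeries.rescale r (eulerianEGF - 1)) *
        (1 + PowerSeries.C X * PowerSeries.rescale r (eulerianEGF - 1)) := by
  have hC : ∀ p : ℝ[X], PowerSeries.rescale r (PowerSeries.C p) = PowerSeries.C p := fun p => by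
    ext1 n
    rw [PowerSeries.coeff_rescale, PowerSeries.coeff_C]
    split_ifs with h <;> simp [h]
  rw [PowerSeries.derivative_rescale, map_sub, PowerSeries.derivative_one, sub_zero, eulerianEGF_ode]
  simp only [map_add, map_mul, map_pow, map_sub, map_one, hC]
  ring

/-- With `G` the rescaled `eulerianEGF - 1`, one has `G' = r (1 + G) (1 + X G)`; differentiating
`exp * (1 + X G) * G ^ j` then involves only the powers `j - 1`, `j`, `j + 1` of `G`. -/
theorem derivative_eulerianColumn (r : ℝ[X]) (j : ℕ) :
    PowerSeries.derivative ℝ[X] (eulerianColumn r j) =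
      PowerSeries.C (r * (j : ℝ[X])) * eulerianColumn r (j - 1) +
      PowerSeries.C (1 + r * (j : ℝ[X]) + r * X * ((j : ℝ[X]) + 1)) * eulerianColumn r j +
      PowerSeries.C (r * X * ((j : ℝ[X]) + 1)) * eulerianColumn r (j + 1) := by
  simp only [eulerianColumn, Derivation.leibniz, Derivation.leibniz_pow, map_add,
    PowerSeries.derivative_one, PowerSeries.derivative_C, PowerSeries.derivative_exp,
    derivative_rescale_eulerianEGF, smul_eq_mul, map_mul, map_one, map_natCast, nsmul_eq_mul]
  cases j with
  | zero => simp; ring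
  | succ j => simp only [Nat.add_sub_cancel]; push_cast; ring

theorem isEulerianArray_eulerianColumn (r : ℝ[X]) :
    IsEulerianArray r X fun n j =>
      (n.factorial : ℝ[X]) * PowerSeries.coeff n (eulerianColumn r j) where
  zero_zero := by
    simp [eulerianColumn, constantCoeff_rescale_eulerianEGF]
  zero_succ j := by
    simp [eulerianColumn, constantCoeff_rescale_eulerianEGF]
  succ n j := by
    have h := congrArg (PowerSeries.coeff n) (derivative_eulerianColumn r j)
    simp only [map_add (PowerSeries.coeff n), PowerSeries.coeff_derivative,
      PowerSeries.coeff_C_mul] at h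
    rw [Nat.factorial_succ]
    push_cast
    linear_combination (n.factorial : ℝ[X]) * h

theorem factorial_mul_coeff_eulerianColumn_zero (r : ℝ[X]) (n : ℕ) :
    (n.factorial : ℝ[X]) * PowerSeries.coeff n (eulerianColumn r 0) =
      1 + X * ∑ m ∈ Finset.Icc 1 n, (n.choose m : ℝ[X]) * r ^ m * eulerianPoly m := by
  have hG : ∀ b, (b.factorial : ℝ[X]) * PowerSeries.coeff b
      (1 + PowerSeries.C X * PowerSeries.rescale r (eulerianEGF - 1)) =
        if b = 0 then 1 else X * (r ^ b * eulerianPoly b) := fun b => by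
    split_ifs with hb
    · simp [hb, constantCoeff_rescale_eulerianEGF]
    · rw [← factorial_mul_coeff_eulerianEGF b, map_add, PowerSeries.coeff_C_mul,
        PowerSeries.coeff_rescale, map_sub, PowerSeries.coeff_one, if_neg hb]
      ring
  have hexp : ∀ a, (a.factorial : ℝ[X]) * PowerSeries.coeff a (PowerSeries.exp ℝ[X]) = 1 :=
    fun a => by
      rw [PowerSeries.coeff_exp, ← map_natCast (algebraMap ℚ ℝ[X]), ← map_mul,
        mul_one_div_cancel (by exact_mod_cast a.factorial_ne_zero), map_one]
  rw [eulerianColumn, pow_zero, mul_one, mul_comm (PowerSeries.exp _), PowerSeries.coeff_mul,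
    Finset.mul_sum]
  have hterm : ∀ p ∈ Finset.HasAntidiagonal.antidiagonal n, (n.factorial : ℝ[X]) *
      (PowerSeries.coeff p.1 (1 + PowerSeries.C X * PowerSeries.rescale r (eulerianEGF - 1)) *
        PowerSeries.coeff p.2 (PowerSeries.exp ℝ[X])) =
      (n.choose p.1 : ℝ[X]) * if p.1 = 0 then 1 else X * (r ^ p.1 * eulerianPoly p.1) := by
    rintro ⟨b, a⟩ hp
    obtain rfl : b + a = n := Finset.HasAntidiagonal.mem_antidiagonal.mp hp
    rw [← hG, ← Nat.add_choose_mul_factorial_mul_factorial b a, ← Nat.choose_symm_add]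
    push_cast
    linear_combination ((b + a).choose b : ℝ[X]) * (b.factorial : ℝ[X]) * PowerSeries.coeff b
      (1 + PowerSeries.C X * PowerSeries.rescale r (eulerianEGF - 1)) * hexp a
  rw [Finset.sum_congr rfl hterm, Finset.Nat.sum_antidiagonal_eq_sum_range_succ_mk,
    Finset.range_eq_Ico, Finset.sum_eq_sum_Ico_succ_bot n.succ_pos, Finset.mul_sum]
  congr 1
  · simp
  · refine Finset.sum_congr rfl fun m hm => ?_
    rw [if_neg (by have := (Finset.mem_Ico.mp hm).1; omega)]
    ring

theorem isQLogConvex_three_of_scaling {r : ℝ[X]} (hr : r ∈ nonnegCoeff) :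
    IsQLogConvex 3 fun n => 1 + X * ∑ m ∈ Finset.Icc 1 (n + 1),
      ((n + 1).choose m : ℝ[X]) * r ^ m * eulerianPoly m := by
  have hX : (X : ℝ[X]) ∈ nonnegCoeff := fun j => by
    rw [coeff_X]; split_ifs <;> norm_num
  refine isQLogConvex_three_of_hankel fun l n => ?_
  -- The shift `n + 1` reflects that the sequence starts at index 1.
  have h := (isEulerianArray_eulerianColumn r).hankel_det_mem nonnegCoeff hr hX l (n + 1)
  convert h using 3
  ext1 i
  ext1 j
  rw [factorial_mul_coeff_eulerianColumn_zero,
    show n + 1 + (i : ℕ) + (j : ℕ) = n + i + j + 1 by omega]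

/-- The sequences of binomial-Eulerian polynomials and of their type B analogues, both with
index running over `n ≥ 1`, are `3`-`q`-log-convex. -/
theorem mainTheorem10 :
    IsQLogConvex 3 (fun n : ℕ => binomialEulerian (n + 1)) ∧
      IsQLogConvex 3 (fun n : ℕ => binomialEulerianB (n + 1)) := by
  have hX : (1 + X : ℝ[X]) ∈ nonnegCoeff := fun j => by
    rw [coeff_add, coeff_X, coeff_one]; split_ifs <;> norm_num
  refine ⟨?_, isQLogConvex_three_of_scaling hX⟩
  simpa [binomialEulerian] using isQLogConvex_three_of_scaling nonnegCoeff.one_mem
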